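/- Let $K\ge 2$ be an integer, let $\varepsilon>0$, and let $X$ be a regular $K$-ary tree, i.e. a rooted tree with root $0$ in which every vertex has exactly $K$ children (a child of $x$ is a neighbour of $x$ that is farther from the root than $x$). For a vertex $z$ let $|z|$ be its distance (number of edges) from the root; regard each edge as an interval of length $1$, and equip $X$ with the uniformizing metric $$d_X(x,y)=\int_{[x,y]}e^{-\varepsilon|z|}\,d|z| ,$$ where $[x,y]$ is the geodesic from $x$ to $y$. The boundary $\partial X$ is the set of infinite geodesics $0x_1x_2x_3\dots$ starting at the root (each $x_{i+1}$ being a child of $x_i$), with the visual metric $d_X(\zeta,\xi)=\int_{[\zeta,\xi]}e^{-\varepsilon|z|}\,d|z|$, the $d_X$-length of the infinite geodesic $[\zeta,\xi]$ joining $\zeta$ and $\xi$. Let $$Q=\frac{\log K}{\varepsilon}$$ be the Hausdorff dimension of $\partial X$, and let $\nu$ be the $Q$-dimensional Hausdorff measure on $\partial X$, normalized so that $\nu(\partial X)=1$. For $p\ge1$, $\theta>0$ and measurable $f:\partial X\to\mathbb R$ put $$E_p(f,t)=\biggl(\int_{\partial X}\frac{1}{\nu(B(\zeta,t))}\int_{B(\zeta,t)}|f(\zeta)-f(\xi)|^p\,d\nu(\xi)\,d\nu(\zeta)\biggr)^{1/p},\qquad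 \|f\|_{B^\theta_{p,p}(\partial X)}=\biggl(\int_0^\infty\Bigl(\frac{E_p(f,t)}{t^\theta}\Bigr)^p\frac{dt}{t}\biggr)^{1/p},$$ where $B(\zeta,t)$ is the open ball in $\partial X$, and let $B^\theta_{p,p}(\partial X)$ be the set of all $f\in L^p(\partial X,\nu)$ with $\|f\|_{B^\theta_{p,p}(\partial X)}<\infty$. **Proposition.** Let $p>1$. Every $u\in B^\theta_{p,p}(\partial X)$ has an $\alpha$-Hölder continuous representative, i.e. there are $v:\partial X\to\mathbb R$ and $C\ge 0$ with $v=u$ $\nu$-a.e. and $|v(\zeta)-v(\xi)|\le C\,d_X(\zeta,\xi)^\alpha$ for all $\zeta,\xi\in\partial X$, provided that one of the following conditions holds: (a) $Q<1$, $\theta\ge\dfrac{Q-1}{p}+1$ and $\alpha=1-\dfrac1p$; (b) $\dfrac Qp<\theta\le\dfrac{Q-1}{p}+1$, $\theta<1$ and $\alpha=\theta-\dfrac Qp$; (c) $Q\ge1$, $\theta\ge1$ and $0<\alpha<1-\dfrac Qp$. -/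

import Mathlib

open MeasureTheory Set
open scoped ENNReal NNReal

noncomputable section

namespace RootedTree

variable {V : Type*}

/-- `y` is a child of `x` in the graph `G` with root `o`: a neighbour of `x` that is one step
further away from the root than `x`. -/
def IsChild (G : SimpleGraph V) (o x y : V) : Prop :=
  G.Adj x y ∧ G.dist o y = G.dist o x + 1

/-- `G` with root `o` is a regular `K`-ary tree: a tree in which each vertex has exactly `K`
children. (For `K ≥ 1`, `ncard = K` says in particular that the set of children is finite.) -/
def IsRegularTree (G : SimpleGraph V) (o : V) (K : ℕ) : Prop :=
  G.IsTree ∧ ∀ x : V, {y : V | IsChild G o x y}.ncard = K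

/-- The boundary `∂X` of the tree `X` with root `o`: a point is an infinite geodesic
`o x₁ x₂ x₃ …` starting at the root, where each vertex is a child of the preceding one.
The parameter `ε` does not affect the points; it determines the metric put on `∂X` below. -/
structure Boundary (G : SimpleGraph V) (o : V) (ε : ℝ) where
  /-- the vertex of the geodesic at distance `n` from the root -/
  vertex : ℕ → V
  vertex_zero : vertex 0 = o
  isChild : ∀ n, IsChild G o (vertex n) (vertex (n + 1))

/-- The length `∫_{[x,y]} e^{-ε|z|} d|z|`, in the uniformizing metric, of an edge `[x,y]` that
joins a vertex `x` with `|x| = n` to a child `y`. -/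
def edgeLength (ε : ℝ) (n : ℕ) : ℝ :=
  ∫ t in (n : ℝ)..(n + 1), Real.exp (-ε * t)

theorem edgeLength_pos (ε : ℝ) (n : ℕ) : 0 < edgeLength ε n := by
  apply intervalIntegral.intervalIntegral_pos_of_pos
  · exact (by fun_prop : Continuous fun t : ℝ => Real.exp (-ε * t)).intervalIntegrable _ _
  · intro t
    exact Real.exp_pos _
  · linarith

theorem edgeLength_le {ε : ℝ} (hε : 0 < ε) (n : ℕ) : edgeLength ε n ≤ Real.exp (-ε) ^ n := by
  have h : ∀ t ∈ Icc (n : ℝ) (n + 1), Real.exp (-ε * t) ≤ Real.exp (-ε) ^ n := by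
    intro t ht
    rw [← Real.exp_nat_mul]
    apply Real.exp_le_exp.2
    nlinarith [ht.1]
  calc edgeLength ε n ≤ ∫ _ in (n : ℝ)..(n + 1), Real.exp (-ε) ^ n := by
        apply intervalIntegral.integral_mono_on (by linarith) _ _ h
        · exact (by fun_prop : Continuous fun t : ℝ => Real.exp (-ε * t)).intervalIntegrable _ _
        · exact continuous_const.intervalIntegrable _ _
    _ = Real.exp (-ε) ^ n := by simp

theorem summable_edgeLength {ε : ℝ} (hε : 0 < ε) : Summable (edgeLength ε) :=
  Summable.of_nonneg_of_le (fun n => (edgeLength_pos ε n).le) (edgeLength_le hε)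
    (summable_geometric_of_lt_one (Real.exp_pos _).le (by simpa using hε))

namespace Boundary

variable {G : SimpleGraph V} {o : V} {ε : ℝ}

open Classical in
/-- The joint contribution to the length of the infinite geodesic `[ζ, ξ]` of the `n`-th edge of
`ζ` and the `n`-th edge of `ξ`, which join level `n` to level `n + 1`. In a tree the two edges
coincide, and then are not part of `[ζ, ξ]`, if and only if they have the same endpoint at level
`n + 1`; otherwise both edges belong to `[ζ, ξ]`. -/
def edgeTerm (ζ ξ : Boundary G o ε) (n : ℕ) : ℝ :=
  if ζ.vertex (n + 1) = ξ.vertex (n + 1) then 0 else 2 * edgeLength ε n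

/-- The visual metric `d_X` on `∂X`: the distance `d_X(ζ, ξ) = ∫_{[ζ,ξ]} e^{-ε|z|} d|z|` is the
length, in the uniformizing metric, of the infinite geodesic `[ζ, ξ]`, i.e. the sum of the lengths
of its edges. -/
instance : Dist (Boundary G o ε) where
  dist ζ ξ := ∑' n, edgeTerm ζ ξ n

theorem edgeTerm_nonneg (ζ ξ : Boundary G o ε) (n : ℕ) : 0 ≤ edgeTerm ζ ξ n := by
  have := edgeLength_pos ε n
  unfold edgeTerm
  split_ifs <;> linarith

theorem summable_edgeTerm (hε : 0 < ε) (ζ ξ : Boundary G o ε) : Summable (edgeTerm ζ ξ) := by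
  refine Summable.of_nonneg_of_le (edgeTerm_nonneg ζ ξ) (fun n => ?_)
    ((summable_edgeLength hε).mul_left 2)
  have := edgeLength_pos ε n
  unfold edgeTerm
  split_ifs <;> linarith

instance [hε : Fact (0 < ε)] : MetricSpace (Boundary G o ε) where
  dist_self ζ := by
    change ∑' n, edgeTerm ζ ζ n = 0
    simp [edgeTerm]
  dist_comm ζ ξ := by
    change ∑' n, edgeTerm ζ ξ n = ∑' n, edgeTerm ξ ζ n
    refine tsum_congr fun n => ?_
    unfold edgeTerm
    by_cases b : ζ.vertex (n + 1) = ξ.vertex (n + 1)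
    · rw [if_pos b, if_pos b.symm]
    · rw [if_neg b, if_neg (Ne.symm b)]
  dist_triangle ζ ξ χ := by
    change ∑' n, edgeTerm ζ χ n ≤ ∑' n, edgeTerm ζ ξ n + ∑' n, edgeTerm ξ χ n
    have h1 := summable_edgeTerm hε.out ζ ξ
    have h2 := summable_edgeTerm hε.out ξ χ
    rw [← h1.tsum_add h2]
    refine (summable_edgeTerm hε.out ζ χ).tsum_le_tsum (fun n => ?_) (h1.add h2)
    have := edgeLength_pos ε n
    unfold edgeTerm
    by_cases b : ζ.vertex (n + 1) = ξ.vertex (n + 1)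
    · rw [b]
      simp
    · split_ifs <;> linarith
  eq_of_dist_eq_zero := by
    intro ζ ξ h
    change ∑' n, edgeTerm ζ ξ n = 0 at h
    have h0 := (hasSum_zero_iff_of_nonneg (edgeTerm_nonneg ζ ξ)).1
      (h ▸ (summable_edgeTerm hε.out ζ ξ).hasSum)
    have hv : ζ.vertex = ξ.vertex := by
      funext n
      cases n with
      | zero => rw [ζ.vertex_zero, ξ.vertex_zero]
      | succ n =>
        by_contra hne
        have h1 : edgeTerm ζ ξ n = 0 := congrFun h0 n
        have := edgeLength_pos ε n
        rw [edgeTerm, if_neg hne] at h1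
        linarith
    cases ζ
    cases ξ
    simpa using hv

instance [Fact (0 < ε)] : MeasurableSpace (Boundary G o ε) := borel _

instance [Fact (0 < ε)] : BorelSpace (Boundary G o ε) := ⟨rfl⟩

end Boundary

end RootedTree

namespace Besov

variable {Z : Type*} [MetricSpace Z] [MeasurableSpace Z] [BorelSpace Z]

/-- The normalized `Q`-dimensional Hausdorff measure on `Z` (a probability measure as soon as the
Hausdorff measure of `Z` is positive and finite). -/
def normalizedHausdorff (Z : Type*) [MetricSpace Z] [MeasurableSpace Z] [BorelSpace Z] (Q : ℝ) :
    Measure Z :=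
  (Measure.hausdorffMeasure Q (univ : Set Z))⁻¹ • Measure.hausdorffMeasure Q

/-- `E_p(f,t) = (∫_Z ⨍_{B(ζ,t)} |f(ζ) - f(ξ)|^p dν(ξ) dν(ζ))^{1/p}`, with values in `[0,∞]`. -/
def modulus (ν : Measure Z) (p : ℝ) (f : Z → ℝ) (t : ℝ) : ℝ≥0∞ :=
  (∫⁻ ζ, ⨍⁻ ξ in Metric.ball ζ t, ENNReal.ofReal (|f ζ - f ξ| ^ p) ∂ν ∂ν) ^ (1 / p)

/-- The Besov seminorm `(∫_0^∞ (E_p(f,t) / t^θ)^q dt/t)^{1/q}`, with values in `[0,∞]`. -/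
def seminorm (ν : Measure Z) (θ p q : ℝ) (f : Z → ℝ) : ℝ≥0∞ :=
  (∫⁻ t in Ioi (0 : ℝ),
    (modulus ν p f t / ENNReal.ofReal (t ^ θ)) ^ q / ENNReal.ofReal t) ^ (1 / q)

/-- `f` belongs to the Besov space `B^θ_{p,q}(Z)`: it is in `L^p(Z)` and has a finite Besov
seminorm. -/
def MemBesov (ν : Measure Z) (θ p q : ℝ) (f : Z → ℝ) : Prop :=
  MemLp f (ENNReal.ofReal p) ν ∧ seminorm ν θ p q f < ∞

end Besov

end


/-
The visual metric on `∂X` is an ultrametric, so the averages of `u` over balls of radius `r` are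
constant on each ball of radius `r`. Finiteness of the Besov seminorm yields a radius
`t ∈ (a, 2a)` with `E_p(u, t) ≤ M t ^ θ` for every scale `a`, and by Jensen's inequality the
averages at two consecutive dyadic scales near `a` differ by at most
`E_p(u, t) / ν(B)^{1/p} ≤ C a ^ (θ - Q / p)`, provided that balls have measure at least `c a ^ Q`.
Hence the averages converge uniformly at a geometric rate, and their limit, which is also their
`L^p` limit `u`, is Hölder continuous with exponent `θ - Q / p`. The lower bound for the measure
of balls comes from self-similarity: grafting a copy of the tree onto a vertex of level `n` embeds
`∂X` in the corresponding cylinder and shrinks distances at most by the factor `e ^ (-ε n)`, so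
that the cylinder has at least the fraction `e ^ (-ε n Q) = K ^ (-n)` of the total mass.
-/

open Filter Topology
section Average

variable {Ω E : Type*} [MeasurableSpace Ω] {μ : Measure Ω} [IsFiniteMeasure μ] [NeZero μ]
  [NormedAddCommGroup E] [NormedSpace ℝ E] {p : ℝ} {g : Ω → E}

theorem enorm_average_rpow_le (hp : 1 ≤ p) (hg : AEStronglyMeasurable g μ) :
    ‖⨍ x, g x ∂μ‖ₑ ^ p ≤ ⨍⁻ x, ‖g x‖ₑ ^ p ∂μ := by
  have hp0 : 0 < p := one_pos.trans_le hp
  have h_norm : ‖⨍ x, g x ∂μ‖ₑ ≤ eLpNorm' g p ((μ univ)⁻¹ • μ) := by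
    refine (enorm_integral_le_lintegral_enorm _).trans ?_
    simpa [eLpNorm'] using
      eLpNorm'_le_eLpNorm'_of_exponent_le one_pos hp ((μ univ)⁻¹ • μ) (hg.smul_measure _)
  calc ‖⨍ x, g x ∂μ‖ₑ ^ p ≤ eLpNorm' g p ((μ univ)⁻¹ • μ) ^ p :=
        ENNReal.rpow_le_rpow h_norm hp0.le
    _ = ⨍⁻ x, ‖g x‖ₑ ^ p ∂μ := by
      rw [eLpNorm', ← ENNReal.rpow_mul, one_div_mul_cancel hp0.ne', ENNReal.rpow_one, laverage_eq']

theorem enorm_sub_average_rpow_le [CompleteSpace E] (hp : 1 ≤ p) (hg : Integrable g μ) (c : E) :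
    ‖c - ⨍ x, g x ∂μ‖ₑ ^ p ≤ ⨍⁻ x, ‖c - g x‖ₑ ^ p ∂μ := by
  have h_sub : ⨍ x, (c - g x) ∂μ = c - ⨍ x, g x ∂μ := by
    conv_rhs => rw [← average_const μ c]
    exact integral_sub (integrable_const c).to_average hg.to_average
  rw [← h_sub]
  exact enorm_average_rpow_le hp (aestronglyMeasurable_const.sub hg.1)

end Average

theorem exists_mul_pow_near {q R d : ℝ} (hq : 0 < q) (hq1 : q < 1) (hd : 0 < d) (hdR : d ≤ R) :
    ∃ n : ℕ, R * q ^ (n + 1) < d ∧ d ≤ R * q ^ n := by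
  have hR : 0 < R := hd.trans_le hdR
  obtain ⟨n, hn, hn'⟩ :=
    exists_nat_pow_near_of_lt_one (div_pos hd hR) ((div_le_one hR).2 hdR) hq hq1
  exact ⟨n, (lt_div_iff₀' hR).1 hn, (div_le_iff₀' hR).1 hn'⟩

theorem exists_tendsto_memHolder {X Y : Type*} [MetricSpace X] [PseudoMetricSpace Y]
    [CompleteSpace Y] {A : ℕ → X → Y} {q R C : ℝ} {α : ℝ≥0} (hq : 0 < q) (hq1 : q < 1) (hR : 0 ≤ R)
    (hdist : ∀ x y : X, dist x y ≤ R) (hC : 0 ≤ C) (hα : 0 < α)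
    (hstep : ∀ n x, dist (A n x) (A (n + 1) x) ≤ C * (R * q ^ n) ^ (α : ℝ))
    (hloc : ∀ n x y, dist x y ≤ R * q ^ n → A n x = A n y) :
    ∃ v : X → Y, (∀ x, Tendsto (A · x) atTop (𝓝 (v x))) ∧ MemHolder α v := by
  set B : ℝ := C / (1 - q ^ (α : ℝ))
  have hqα : q ^ (α : ℝ) < 1 := Real.rpow_lt_one hq.le hq1 hα
  have : 0 ≤ B := div_nonneg hC (sub_nonneg.2 hqα.le)
  have hscale : ∀ n : ℕ, C * (R * q ^ n) ^ (α : ℝ) = C * R ^ (α : ℝ) * (q ^ (α : ℝ)) ^ n :=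
    fun n => by rw [Real.mul_rpow hR (by positivity), Real.rpow_pow_comm hq.le, mul_assoc]
  simp only [hscale] at hstep
  choose v hv using fun x =>
    cauchySeq_tendsto_of_complete (cauchySeq_of_le_geometric _ _ hqα (hstep · x))
  have htail : ∀ x n, dist (A n x) (v x) ≤ B * (R * q ^ n) ^ (α : ℝ) := fun x n => by
    have := dist_le_of_le_geometric_of_tendsto _ _ hqα (hstep · x) (hv x) n
    rwa [← hscale, mul_div_right_comm] at this
  refine ⟨v, hv, HolderWith.memHolder (C := (2 * B * q⁻¹ ^ (α : ℝ)).toNNReal) fun x y => ?_⟩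
  rw [edist_dist, edist_dist, ENNReal.ofReal_rpow_of_nonneg dist_nonneg α.coe_nonneg,
    ← ENNReal.ofReal, ← ENNReal.ofReal_mul (by positivity)]
  refine ENNReal.ofReal_le_ofReal ?_
  rcases eq_or_ne x y with rfl | hne
  · rw [dist_self]
    positivity
  obtain ⟨n, hn, hn'⟩ := exists_mul_pow_near hq hq1 (dist_pos.2 hne) (hdist x y)
  have hn_le : R * q ^ n ≤ q⁻¹ * dist x y := by
    rw [← div_eq_inv_mul, le_div_iff₀ hq, mul_assoc, ← pow_succ]
    exact hn.le
  calc dist (v x) (v y) ≤ dist (A n x) (v x) + dist (A n y) (v y) := by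
        rw [← hloc n x y hn']
        exact dist_triangle_left _ _ _
    _ ≤ 2 * B * (R * q ^ n) ^ (α : ℝ) := by linarith [htail x n, htail y n]
    _ ≤ 2 * B * (q⁻¹ * dist x y) ^ (α : ℝ) := by gcongr
    _ = 2 * B * q⁻¹ ^ (α : ℝ) * dist x y ^ (α : ℝ) := by
        rw [Real.mul_rpow (inv_pos.2 hq).le dist_nonneg, ← mul_assoc]

namespace Besov

variable {Z : Type*} [MetricSpace Z] [MeasurableSpace Z] {ν : Measure Z} {p : ℝ} {u : Z → ℝ}

theorem modulus_rpow (hp : 0 < p) (ν : Measure Z) (u : Z → ℝ) (t : ℝ) :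
    modulus ν p u t ^ p = ∫⁻ x, ⨍⁻ y in Metric.ball x t, ‖u x - u y‖ₑ ^ p ∂ν ∂ν := by
  simp_rw [modulus, ← ENNReal.rpow_mul, one_div_mul_cancel hp.ne', ENNReal.rpow_one,
    Real.enorm_eq_ofReal_abs, ENNReal.ofReal_rpow_of_nonneg (abs_nonneg _) hp.le]

theorem exists_modulus_le {θ q : ℝ} (hq : 0 < q) (h : seminorm ν θ p q u < ∞) :
    ∃ M : ℝ, 0 ≤ M ∧
      ∀ a : ℝ, 0 < a → ∃ t ∈ Ioo a (2 * a), modulus ν p u t ≤ ENNReal.ofReal (M * t ^ θ) := by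
  set F : ℝ → ℝ≥0∞ := fun t =>
    (modulus ν p u t / ENNReal.ofReal (t ^ θ)) ^ q / ENNReal.ofReal t
  set S : ℝ≥0∞ := ∫⁻ t in Ioi (0 : ℝ), F t
  have hS_top : S ≠ ∞ := ((ENNReal.rpow_lt_top_iff_of_pos (one_div_pos.2 hq)).1 h).ne
  set M : ℝ := (2 * (S.toReal + 1)) ^ (1 / q) with hM
  have hMq : M ^ q = 2 * (S.toReal + 1) := by
    rw [hM, ← Real.rpow_mul (by positivity), one_div_mul_cancel hq.ne', Real.rpow_one]
  refine ⟨M, by positivity, fun a ha => ?_⟩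
  by_contra! hlarge
  have hF_le : ∀ t ∈ Ioo a (2 * a), ENNReal.ofReal (M ^ q / (2 * a)) ≤ F t := by
    intro t ht
    have ht0 : 0 < t := ha.trans ht.1
    rw [ENNReal.ofReal_div_of_pos (by positivity),
      ← ENNReal.ofReal_rpow_of_nonneg (by positivity) hq.le]
    refine ENNReal.div_le_div (ENNReal.rpow_le_rpow ?_ hq.le) (ENNReal.ofReal_le_ofReal ht.2.le)
    rw [ENNReal.le_div_iff_mul_le (by simp [Real.rpow_pos_of_pos ht0]) (by simp),
      ← ENNReal.ofReal_mul (by positivity)]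
    exact (hlarge t ht).le
  have hS_le : ENNReal.ofReal (S.toReal + 1) ≤ S :=
    calc ENNReal.ofReal (S.toReal + 1)
        = ENNReal.ofReal (M ^ q / (2 * a)) * volume (Ioo a (2 * a)) := by
          rw [Real.volume_Ioo, ← ENNReal.ofReal_mul (by positivity), hMq]
          congr 1
          field_simp
          ring
      _ = ∫⁻ _ in Ioo a (2 * a), ENNReal.ofReal (M ^ q / (2 * a)) := (setLIntegral_const _ _).symm
      _ ≤ ∫⁻ t in Ioo a (2 * a), F t := setLIntegral_mono' measurableSet_Ioo hF_le
      _ ≤ S := lintegral_mono_set fun t ht => ha.trans ht.1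
  rw [ENNReal.ofReal_le_iff_le_toReal hS_top] at hS_le
  linarith

instance [BorelSpace Z] (Q : ℝ) : IsZeroOrProbabilityMeasure (normalizedHausdorff Z Q) :=
  inferInstanceAs (IsZeroOrProbabilityMeasure ((Measure.hausdorffMeasure Q univ)⁻¹ • _))

/-- The average of `u` over the open ball of radius `r` around `x`. -/
noncomputable def ballAverage (ν : Measure Z) (u : Z → ℝ) (r : ℝ) (x : Z) : ℝ :=
  ⨍ y in Metric.ball x r, u y ∂ν

/-- The lower half of Ahlfors `Q`-regularity up to the scale `R`: balls of radius `r ≤ R` have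
measure at least `c r ^ Q`. -/
def IsLowerRegular (ν : Measure Z) (Q R : ℝ) : Prop :=
  ∃ c : ℝ, 0 < c ∧ ∀ x, ∀ r ∈ Ioc 0 R, ENNReal.ofReal (c * r ^ Q) ≤ ν (Metric.ball x r)

theorem IsLowerRegular.isOpenPosMeasure {Q R : ℝ} (hR : 0 < R) (hν : IsLowerRegular ν Q R) :
    ν.IsOpenPosMeasure := by
  obtain ⟨c, hc, hball⟩ := hν
  refine ⟨fun U hU ⟨x, hx⟩ => ?_⟩
  obtain ⟨r, hr, hrU⟩ := Metric.isOpen_iff.1 hU x hx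
  have hr' : 0 < min r R := lt_min hr hR
  refine ne_of_gt (lt_of_lt_of_le ?_ ((hball x (min r R) ⟨hr', min_le_right _ _⟩).trans
    (measure_mono ((Metric.ball_subset_ball (min_le_left _ _)).trans hrU))))
  exact ENNReal.ofReal_pos.2 (mul_pos hc (Real.rpow_pos_of_pos hr' Q))

section Ultrametric

variable [IsUltrametricDist Z]

theorem ballAverage_eq_of_dist_lt (ν : Measure Z) (u : Z → ℝ) {r : ℝ} {x y : Z}
    (h : dist x y < r) : ballAverage ν u r x = ballAverage ν u r y := by
  rw [ballAverage, ballAverage, IsUltrametricDist.ball_eq_of_mem (Metric.mem_ball'.2 h)]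

theorem continuous_ballAverage (ν : Measure Z) (u : Z → ℝ) {r : ℝ} (hr : 0 < r) :
    Continuous (ballAverage ν u r) :=
  ((IsLocallyConstant.iff_exists_open _).2 fun x =>
    ⟨Metric.ball x r, Metric.isOpen_ball, Metric.mem_ball_self hr,
      fun _ hy => ballAverage_eq_of_dist_lt ν u hy⟩).continuous

end Ultrametric

variable [IsFiniteMeasure ν]

section OpenPos

variable [ν.IsOpenPosMeasure]

theorem enorm_sub_ballAverage_rpow_le (hp : 1 ≤ p) (hu : Integrable u ν) {r : ℝ} (hr : 0 < r)
    (c : ℝ) (x : Z) :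
    ‖c - ballAverage ν u r x‖ₑ ^ p ≤ ⨍⁻ y in Metric.ball x r, ‖c - u y‖ₑ ^ p ∂ν := by
  have : NeZero (ν.restrict (Metric.ball x r)) :=
    ⟨fun h => (Metric.measure_ball_pos ν x hr).ne' (Measure.restrict_eq_zero.1 h)⟩
  exact enorm_sub_average_rpow_le hp hu.restrict c

theorem eLpNorm_ballAverage_sub_le (hp : 1 ≤ p) (hu : Integrable u ν) {r : ℝ} (hr : 0 < r) :
    eLpNorm (ballAverage ν u r - u) (ENNReal.ofReal p) ν ≤ modulus ν p u r := by
  have hp0 : 0 < p := one_pos.trans_le hp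
  rw [eLpNorm_sub_comm, eLpNorm_eq_eLpNorm' (by simpa using hp0) ENNReal.ofReal_ne_top,
    ENNReal.toReal_ofReal hp0.le, ← ENNReal.rpow_le_rpow_iff hp0, modulus_rpow hp0, eLpNorm',
    ← ENNReal.rpow_mul, one_div_mul_cancel hp0.ne', ENNReal.rpow_one]
  exact lintegral_mono fun x => enorm_sub_ballAverage_rpow_le hp hu hr (u x) x

theorem tendsto_eLpNorm_ballAverage_sub {ι : Type*} {l : Filter ι} {t : ι → ℝ} {θ M : ℝ}
    (hp : 1 ≤ p) (hu : Integrable u ν) (hθ : 0 < θ) (ht_pos : ∀ i, 0 < t i)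
    (ht : Tendsto t l (𝓝 0)) (hmod : ∀ i, modulus ν p u (t i) ≤ ENNReal.ofReal (M * t i ^ θ)) :
    Tendsto (fun i => eLpNorm (ballAverage ν u (t i) - u) (ENNReal.ofReal p) ν) l (𝓝 0) := by
  have hlim : Tendsto (fun i => ENNReal.ofReal (M * t i ^ θ)) l (𝓝 0) := by
    simpa [Real.zero_rpow hθ.ne'] using
      ENNReal.tendsto_ofReal ((ht.rpow_const (Or.inr hθ.le)).const_mul M)
  exact tendsto_of_tendsto_of_tendsto_of_le_of_le tendsto_const_nhds hlim (fun _ => zero_le)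
    fun i => (eLpNorm_ballAverage_sub_le hp hu (ht_pos i)).trans (hmod i)

theorem edist_ballAverage_le [BorelSpace Z] [IsUltrametricDist Z] (hp : 1 ≤ p)
    (hu : Integrable u ν) {r s : ℝ} (hs : 0 < s) (hsr : s ≤ r) (x : Z) :
    edist (ballAverage ν u r x) (ballAverage ν u s x) ≤
      modulus ν p u r / ν (Metric.ball x s) ^ (1 / p) := by
  have hp0 : 0 < p := one_pos.trans_le hp
  rw [edist_eq_enorm_sub, ← ENNReal.rpow_le_rpow_iff hp0, ENNReal.div_rpow_of_nonneg _ _ hp0.le,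
    modulus_rpow hp0, ← ENNReal.rpow_mul, one_div_mul_cancel hp0.ne', ENNReal.rpow_one]
  calc ‖ballAverage ν u r x - ballAverage ν u s x‖ₑ ^ p
      ≤ (∫⁻ y in Metric.ball x s, ‖ballAverage ν u r x - u y‖ₑ ^ p ∂ν) /
          ν (Metric.ball x s) := by
        rw [← setLAverage_eq]
        exact enorm_sub_ballAverage_rpow_le hp hu hs _ x
    _ ≤ (∫⁻ y in Metric.ball x s, ⨍⁻ z in Metric.ball y r, ‖u y - u z‖ₑ ^ p ∂ν ∂ν) /
          ν (Metric.ball x s) := by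
        gcongr ?_ / _
        refine setLIntegral_mono' Metric.isOpen_ball.measurableSet fun y hy => ?_
        rw [← ballAverage_eq_of_dist_lt ν u (hy.trans_le hsr), ← enorm_neg, neg_sub]
        exact enorm_sub_ballAverage_rpow_le hp hu (hs.trans_le hsr) (u y) y
    _ ≤ (∫⁻ y, ⨍⁻ z in Metric.ball y r, ‖u y - u z‖ₑ ^ p ∂ν ∂ν) / ν (Metric.ball x s) := by
        gcongr
        exact Measure.restrict_le_self

end OpenPos

variable [BorelSpace Z] [IsUltrametricDist Z]

theorem exists_dist_ballAverage_le (hp : 1 ≤ p) (hu : Integrable u ν) {Q R θ M : ℝ}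
    (hQ : 0 ≤ Q) (hθ : 0 ≤ θ) (hM : 0 ≤ M) (hν : IsLowerRegular ν Q R) :
    ∃ C : ℝ, 0 ≤ C ∧ ∀ a ∈ Ioc 0 R, ∀ t ∈ Ioo a (2 * a), ∀ s ∈ Ioo (a / 2) a,
      modulus ν p u t ≤ ENNReal.ofReal (M * t ^ θ) →
      ∀ x, dist (ballAverage ν u t x) (ballAverage ν u s x) ≤ C * a ^ (θ - Q / p) := by
  have : 0 < p := one_pos.trans_le hp
  have ⟨c, hc, hball⟩ := hν
  refine ⟨M * 2 ^ θ / (c * 2⁻¹ ^ Q) ^ (1 / p), by positivity, ?_⟩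
  rintro a ⟨ha, haR⟩ t ⟨hat, hta⟩ s ⟨has, hsa⟩ hmod x
  have : ν.IsOpenPosMeasure := hν.isOpenPosMeasure (ha.trans_le haR)
  have hs : 0 < s := (half_pos ha).trans has
  have ht : 0 < t := ha.trans hat
  rw [← ENNReal.ofReal_le_ofReal_iff (by positivity), ← edist_dist]
  calc edist (ballAverage ν u t x) (ballAverage ν u s x)
      ≤ modulus ν p u t / ν (Metric.ball x s) ^ (1 / p) :=
        edist_ballAverage_le hp hu hs (hsa.trans hat).le x
    _ ≤ ENNReal.ofReal (M * t ^ θ) / ENNReal.ofReal (c * s ^ Q) ^ (1 / p) := by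
        gcongr
        exact hball x s ⟨hs, (hsa.trans_le haR).le⟩
    _ = ENNReal.ofReal (M * t ^ θ / (c * s ^ Q) ^ (1 / p)) := by
        rw [ENNReal.ofReal_rpow_of_pos (by positivity), ENNReal.ofReal_div_of_pos (by positivity)]
    _ ≤ ENNReal.ofReal (M * (2 * a) ^ θ / (c * (2⁻¹ * a) ^ Q) ^ (1 / p)) := by
        rw [← div_eq_inv_mul a 2]
        gcongr
    _ = ENNReal.ofReal (M * 2 ^ θ / (c * 2⁻¹ ^ Q) ^ (1 / p) * a ^ (θ - Q / p)) := by
        congr 1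
        rw [Real.mul_rpow two_pos.le ha.le, Real.mul_rpow (by norm_num) ha.le, ← mul_assoc c,
          Real.mul_rpow (by positivity) (by positivity), ← Real.rpow_mul ha.le, mul_one_div,
          Real.rpow_sub ha]
        field_simp

theorem exists_memHolder_of_memBesov {Q R θ : ℝ} {α : ℝ≥0} (hQ : 0 ≤ Q) (hR : 0 < R)
    (hdist : ∀ x y : Z, dist x y ≤ R) (hν : IsLowerRegular ν Q R) (hp : 1 ≤ p)
    (hθ : Q / p < θ) (hα : α ≤ θ - Q / p) (hu : MemBesov ν θ p p u) :
    ∃ v : Z → ℝ, v =ᵐ[ν] u ∧ MemHolder α v := by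
  have hp0 : 0 < p := one_pos.trans_le hp
  have hθ0 : 0 < θ := (div_nonneg hQ hp0.le).trans_lt hθ
  have hu_int : Integrable u ν := hu.1.integrable (by simpa using hp)
  have : ν.IsOpenPosMeasure := hν.isOpenPosMeasure hR
  have : BoundedSpace Z := ⟨Metric.isBounded_iff.2 ⟨R, fun x _ y _ => hdist x y⟩⟩
  set a : ℕ → ℝ := fun n => R * 2⁻¹ ^ n
  have ha : ∀ n, a n ∈ Ioc 0 R := fun n =>
    ⟨by positivity, mul_le_of_le_one_right hR.le (pow_le_one₀ (by norm_num) (by norm_num))⟩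
  have ha_succ : ∀ n, a (n + 1) = a n / 2 := fun n => by simp only [a, pow_succ]; ring
  obtain ⟨M, hM, hmod⟩ := exists_modulus_le hp0 hu.2
  choose t ht hmod_t using fun n => hmod (a n) (ha n).1
  have ht_pos : ∀ n, 0 < t n := fun n => (ha n).1.trans (ht n).1
  have ht_lim : Tendsto t atTop (𝓝 0) := by
    refine squeeze_zero (fun n => (ht_pos n).le) (fun n => (ht n).2.le) ?_
    simpa [a] using ((tendsto_pow_atTop_nhds_zero_of_lt_one (r := (2⁻¹ : ℝ)) (by norm_num)
      (by norm_num)).const_mul R).const_mul 2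
  have ht_succ : ∀ n, t (n + 1) ∈ Ioo (a n / 2) (a n) := fun n => by
    simpa only [ha_succ, mul_div_cancel₀ _ (two_ne_zero' ℝ)] using ht (n + 1)
  obtain ⟨C, hC, hstep⟩ := exists_dist_ballAverage_le hp hu_int hQ hθ0.le hM hν
  obtain ⟨v, hv_lim, hv⟩ := exists_tendsto_memHolder (A := fun n => ballAverage ν u (t n))
    (α := ⟨θ - Q / p, (sub_pos.2 hθ).le⟩) (by norm_num) (by norm_num) hR.le hdist hC
    (sub_pos.2 hθ) (fun n => hstep _ (ha n) _ (ht n) _ (ht_succ n) (hmod_t n))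
    (fun n _ _ hxy => ballAverage_eq_of_dist_lt ν u (hxy.trans_lt (ht n).1))
  have hmeas : ∀ n, AEStronglyMeasurable (ballAverage ν u (t n)) ν := fun n =>
    (continuous_ballAverage ν u (ht_pos n)).aestronglyMeasurable
  have hv_ae : TendstoInMeasure ν (fun n => ballAverage ν u (t n)) atTop v :=
    tendstoInMeasure_of_tendsto_ae hmeas (Eventually.of_forall hv_lim)
  have hu_Lp : TendstoInMeasure ν (fun n => ballAverage ν u (t n)) atTop u :=
    tendstoInMeasure_of_tendsto_eLpNorm (by simpa using hp0) hmeas hu_int.1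
      (tendsto_eLpNorm_ballAverage_sub hp hu_int hθ0 ht_pos ht_lim hmod_t)
  exact ⟨v, tendstoInMeasure_ae_unique hv_ae hu_Lp, hv.of_le hα⟩

end Besov

namespace TreeBoundary

open Besov RootedTree RootedTree.Boundary

variable {V : Type*} {G : SimpleGraph V} {o : V} {ε : ℝ} {K : ℕ}

theorem eq_of_isChild (hG : G.IsTree) {x x' y : V} (h : IsChild G o x y)
    (h' : IsChild G o x' y) : x = x' := by
  have exists_path : ∀ {z : V}, IsChild G o z y →
      ∃ w : G.Walk o y, w.IsPath ∧ w.penultimate = z := by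
    intro z hz
    obtain ⟨w, hw⟩ := (hG.connected o z).exists_walk_length_eq_dist
    refine ⟨w.concat hz.1, SimpleGraph.Walk.isPath_of_length_eq_dist _ ?_, by simp⟩
    rw [SimpleGraph.Walk.length_concat, hw, hz.2]
  obtain ⟨w, hw, rfl⟩ := exists_path h
  obtain ⟨w', hw', rfl⟩ := exists_path h'
  rw [(hG.existsUnique_path o y).unique hw hw']

theorem edgeLength_eq (ε : ℝ) (n : ℕ) : edgeLength ε n = Real.exp (-ε) ^ n * edgeLength ε 0 := by
  have hshift := intervalIntegral.integral_comp_add_right (a := 0) (b := 1)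
    (fun t : ℝ => Real.exp (-ε * t)) (n : ℝ)
  rw [zero_add, add_comm 1 (n : ℝ)] at hshift
  rw [edgeLength, edgeLength, ← hshift, ← intervalIntegral.integral_const_mul, Nat.cast_zero,
    zero_add]
  refine intervalIntegral.integral_congr fun t _ => ?_
  rw [← Real.exp_nat_mul, ← Real.exp_add]
  ring_nf

/-- The diameter of `∂X` in the visual metric: the length of a geodesic through the root. -/
noncomputable def diameter (ε : ℝ) : ℝ := 2 * ∑' n, edgeLength ε n

theorem diameter_pos (hε : 0 < ε) : 0 < diameter ε :=
  mul_pos two_pos ((summable_edgeLength hε).tsum_pos (fun n => (edgeLength_pos ε n).le) 0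
    (edgeLength_pos ε 0))

theorem tsum_two_mul_edgeLength_add (ε : ℝ) (n : ℕ) :
    ∑' k, 2 * edgeLength ε (k + n) = diameter ε * Real.exp (-ε) ^ n := by
  rw [diameter, ← tsum_mul_left, ← tsum_mul_right]
  refine tsum_congr fun k => ?_
  rw [edgeLength_eq ε (k + n), edgeLength_eq ε k, pow_add]
  ring

theorem vertex_injective : Function.Injective (vertex : Boundary G o ε → ℕ → V) := by
  rintro ⟨⟩ ⟨⟩ h
  simpa using h

theorem vertex_eq_of_le (hG : G.IsTree) {x y : Boundary G o ε} {m n : ℕ} (hmn : m ≤ n)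
    (h : x.vertex n = y.vertex n) : x.vertex m = y.vertex m := by
  induction n, hmn using Nat.le_induction with
  | base => exact h
  | succ n _ ih => exact ih (eq_of_isChild hG (x.isChild n) (h ▸ y.isChild n))

theorem exists_vertex_succ_ne {x y : Boundary G o ε} (hne : x ≠ y) :
    ∃ n, x.vertex n = y.vertex n ∧ x.vertex (n + 1) ≠ y.vertex (n + 1) := by
  by_contra! h
  refine hne (vertex_injective (funext fun n => ?_))
  induction n with
  | zero => rw [x.vertex_zero, y.vertex_zero]
  | succ n ih => exact h n ih

/-- The points of `∂X` whose geodesics agree with that of `x` up to level `n`. -/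
def cylinder (n : ℕ) (x : Boundary G o ε) : Set (Boundary G o ε) :=
  {y | y.vertex n = x.vertex n}

section Metric

variable [hε : Fact (0 < ε)]

theorem dist_le_of_vertex_eq (hG : G.IsTree) {x y : Boundary G o ε} {n : ℕ}
    (h : x.vertex n = y.vertex n) : dist x y ≤ diameter ε * Real.exp (-ε) ^ n := by
  have hsum := summable_edgeTerm hε.out x y
  have hinit : ∑ k ∈ Finset.range n, edgeTerm x y k = 0 := Finset.sum_eq_zero fun k hk =>
    if_pos (vertex_eq_of_le hG (Finset.mem_range.1 hk) h)
  change ∑' k, edgeTerm x y k ≤ _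
  rw [← hsum.sum_add_tsum_nat_add n, hinit, zero_add, ← tsum_two_mul_edgeLength_add]
  refine ((summable_nat_add_iff n).2 hsum).tsum_le_tsum (fun k => ?_)
    ((summable_nat_add_iff n).2 ((summable_edgeLength hε.out).mul_left 2))
  have := edgeLength_pos ε (k + n)
  unfold edgeTerm
  split_ifs <;> linarith

theorem le_dist_of_vertex_ne (hG : G.IsTree) {x y : Boundary G o ε} {n : ℕ}
    (h : x.vertex (n + 1) ≠ y.vertex (n + 1)) : diameter ε * Real.exp (-ε) ^ n ≤ dist x y := by
  have hsum := summable_edgeTerm hε.out x y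
  have htail : ∀ k, edgeTerm x y (k + n) = 2 * edgeLength ε (k + n) := fun k =>
    if_neg fun hk => h (vertex_eq_of_le hG (by lia) hk)
  change _ ≤ ∑' k, edgeTerm x y k
  rw [← hsum.sum_add_tsum_nat_add n, ← tsum_two_mul_edgeLength_add, tsum_congr htail]
  exact le_add_of_nonneg_left (Finset.sum_nonneg fun k _ => edgeTerm_nonneg x y k)

theorem dist_le_diameter (hG : G.IsTree) (x y : Boundary G o ε) : dist x y ≤ diameter ε := by
  simpa using dist_le_of_vertex_eq hG (n := 0) (x.vertex_zero.trans y.vertex_zero.symm)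

theorem isUltrametricDist (hG : G.IsTree) : IsUltrametricDist (Boundary G o ε) where
  dist_triangle_max x y z := by
    rcases eq_or_ne x z with rfl | hne
    · simp
    obtain ⟨n, hn, hn'⟩ := exists_vertex_succ_ne hne
    refine (dist_le_of_vertex_eq hG hn).trans (le_max_iff.2 ?_)
    by_cases hxy : x.vertex (n + 1) = y.vertex (n + 1)
    · exact Or.inr (le_dist_of_vertex_ne hG (hxy ▸ hn'))
    · exact Or.inl (le_dist_of_vertex_ne hG hxy)

theorem cylinder_subset_ball (hG : G.IsTree) (x : Boundary G o ε) {n : ℕ} {r : ℝ}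
    (hr : diameter ε * Real.exp (-ε) ^ n < r) : cylinder n x ⊆ Metric.ball x r :=
  fun _ hy => (dist_le_of_vertex_eq hG hy).trans_lt hr

end Metric

section Copy

/-- A choice, for any two vertices `a` and `b`, of an embedding `e a b` of the children of `a`
into the children of `b`. -/
structure IsChildEmbedding (G : SimpleGraph V) (o : V) (e : V → V → V → V) : Prop where
  isChild : ∀ {a b y}, IsChild G o a y → IsChild G o b (e a b y)
  injOn : ∀ a b, InjOn (e a b) {y | IsChild G o a y}

theorem exists_isChildEmbedding (hK : K ≠ 0) (hG : IsRegularTree G o K) :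
    ∃ e, IsChildEmbedding G o e := by
  have hfin : ∀ x, {y | IsChild G o x y}.Finite := fun x =>
    finite_of_ncard_ne_zero (by rwa [hG.2 x])
  have hcard : ∀ a b, {y | IsChild G o a y}.encard ≤ {y | IsChild G o b y}.encard := fun a b => by
    rw [← (hfin a).cast_ncard_eq, ← (hfin b).cast_ncard_eq, hG.2, hG.2]
  have : Nonempty V := ⟨o⟩
  choose e hmaps hinj using fun a b => (hfin a).exists_injOn_of_encard_le (hcard a b)
  exact ⟨e, fun hy => hmaps _ _ hy, hinj⟩

/-- The vertices of the geodesic that starts at `a` and copies the geodesic of `x`. -/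
def copyVertex (e : V → V → V → V) (a : V) (x : Boundary G o ε) : ℕ → V
  | 0 => a
  | m + 1 => e (x.vertex m) (copyVertex e a x m) (x.vertex (m + 1))

variable {e : V → V → V → V}

theorem isChild_copyVertex (he : IsChildEmbedding G o e) (a : V) (x : Boundary G o ε) (m : ℕ) :
    IsChild G o (copyVertex e a x m) (copyVertex e a x (m + 1)) :=
  he.isChild (x.isChild m)

theorem vertex_eq_of_copyVertex_eq (hG : G.IsTree) (he : IsChildEmbedding G o e) (a : V)
    {x y : Boundary G o ε} {m : ℕ} (h : copyVertex e a x m = copyVertex e a y m) :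
    x.vertex m = y.vertex m := by
  induction m with
  | zero => rw [x.vertex_zero, y.vertex_zero]
  | succ m ih =>
    have hcopy : copyVertex e a x m = copyVertex e a y m :=
      eq_of_isChild hG (isChild_copyVertex he a x m) (h ▸ isChild_copyVertex he a y m)
    rw [copyVertex, copyVertex, hcopy, ih hcopy] at h
    exact he.injOn _ _ (ih hcopy ▸ x.isChild m) (y.isChild m) h

/-- The point of `∂X` that follows `x` up to level `n` and copies `y` from there on. -/
def graft (he : IsChildEmbedding G o e) (n : ℕ) (x y : Boundary G o ε) : Boundary G o ε where
  vertex k := if k ≤ n then x.vertex k else copyVertex e (x.vertex n) y (k - n)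
  vertex_zero := by simp [x.vertex_zero]
  isChild k := by
    rcases lt_trichotomy k n with hk | rfl | hk
    · rw [if_pos hk.le, if_pos (Nat.succ_le_of_lt hk)]
      exact x.isChild k
    · rw [if_pos le_rfl, if_neg (by lia), Nat.add_sub_cancel_left]
      exact isChild_copyVertex he _ y 0
    · rw [if_neg (by lia), if_neg (by lia), Nat.sub_add_comm hk.le]
      exact isChild_copyVertex he _ y _

theorem graft_mem_cylinder (he : IsChildEmbedding G o e) (n : ℕ) (x y : Boundary G o ε) :
    graft he n x y ∈ cylinder n x := by
  simp [cylinder, graft]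

theorem vertex_graft_add (he : IsChildEmbedding G o e) (n : ℕ) (x y : Boundary G o ε) (m : ℕ) :
    (graft he n x y).vertex (n + m + 1) = copyVertex e (x.vertex n) y (m + 1) := by
  simp [graft, add_assoc]

variable [hε : Fact (0 < ε)]

theorem antilipschitzWith_graft (hG : G.IsTree) (he : IsChildEmbedding G o e) (n : ℕ)
    (x : Boundary G o ε) :
    AntilipschitzWith (Real.exp ε ^ n).toNNReal (graft he n x) := by
  refine AntilipschitzWith.of_le_mul_dist fun y z => ?_
  rcases eq_or_ne y z with rfl | hne
  · simp
  obtain ⟨m, hm, hm'⟩ := exists_vertex_succ_ne hne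
  have hgraft : (graft he n x y).vertex (n + m + 1) ≠ (graft he n x z).vertex (n + m + 1) := by
    rw [vertex_graft_add, vertex_graft_add]
    exact mt (vertex_eq_of_copyVertex_eq hG he _) hm'
  rw [Real.coe_toNNReal _ (by positivity)]
  calc dist y z ≤ diameter ε * Real.exp (-ε) ^ m := dist_le_of_vertex_eq hG hm
    _ = Real.exp ε ^ n * (diameter ε * Real.exp (-ε) ^ (n + m)) := by
      rw [pow_add, Real.exp_neg, inv_pow, inv_pow, mul_left_comm,
        mul_inv_cancel_left₀ (by positivity)]
    _ ≤ Real.exp ε ^ n * dist (graft he n x y) (graft he n x z) := by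
      gcongr
      exact le_dist_of_vertex_ne hG hgraft

end Copy

section Measure

variable [hε : Fact (0 < ε)]

theorem hausdorffMeasure_univ_le (hK : K ≠ 0) (hG : IsRegularTree G o K) (n : ℕ)
    (x : Boundary G o ε) :
    Measure.hausdorffMeasure (Real.log K / ε) (univ : Set (Boundary G o ε)) ≤
      (K : ℝ≥0∞) ^ n * Measure.hausdorffMeasure (Real.log K / ε) (cylinder n x) := by
  obtain ⟨e, he⟩ := exists_isChildEmbedding hK hG
  have hQ : 0 ≤ Real.log K / ε := div_nonneg (Real.log_natCast_nonneg K) hε.out.le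
  have hpre : graft he n x ⁻¹' cylinder n x = univ := eq_univ_of_forall (graft_mem_cylinder he n x)
  have hconst : (Real.exp ε ^ n) ^ (Real.log K / ε) = (K : ℝ) ^ n := by
    rw [← Real.rpow_pow_comm (Real.exp_pos ε).le, ← Real.exp_mul,
      mul_div_cancel₀ _ hε.out.ne', Real.exp_log (by positivity)]
  calc Measure.hausdorffMeasure (Real.log K / ε) (univ : Set (Boundary G o ε))
      ≤ ((Real.exp ε ^ n).toNNReal : ℝ≥0∞) ^ (Real.log K / ε) *
          Measure.hausdorffMeasure (Real.log K / ε) (cylinder n x) := by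
        simpa only [hpre] using
          (antilipschitzWith_graft hG.1 he n x).hausdorffMeasure_preimage_le hQ (cylinder n x)
    _ = (K : ℝ≥0∞) ^ n * Measure.hausdorffMeasure (Real.log K / ε) (cylinder n x) := by
        rw [← ENNReal.ofReal, ENNReal.ofReal_rpow_of_nonneg (by positivity) hQ, hconst,
          ENNReal.ofReal_pow (by positivity), ENNReal.ofReal_natCast]

theorem one_le_pow_mul_cylinder (hK : K ≠ 0) (hG : IsRegularTree G o K)
    [IsProbabilityMeasure (normalizedHausdorff (Boundary G o ε) (Real.log K / ε))] (n : ℕ)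
    (x : Boundary G o ε) :
    1 ≤ (K : ℝ≥0∞) ^ n *
      normalizedHausdorff (Boundary G o ε) (Real.log K / ε) (cylinder n x) := by
  rw [← measure_univ (μ := normalizedHausdorff (Boundary G o ε) (Real.log K / ε)),
    normalizedHausdorff, Measure.smul_apply, Measure.smul_apply, smul_eq_mul, smul_eq_mul,
    mul_left_comm]
  gcongr
  exact hausdorffMeasure_univ_le hK hG n x

theorem isLowerRegular_normalizedHausdorff (hK : K ≠ 0) (hG : IsRegularTree G o K)
    [IsProbabilityMeasure (normalizedHausdorff (Boundary G o ε) (Real.log K / ε))] :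
    IsLowerRegular (normalizedHausdorff (Boundary G o ε) (Real.log K / ε))
      (Real.log K / ε) (diameter ε) := by
  set Q := Real.log K / ε
  set q := Real.exp (-ε)
  have hq : 0 < q := Real.exp_pos _
  have hQ : 0 ≤ Q := div_nonneg (Real.log_natCast_nonneg K) hε.out.le
  have hdiam := diameter_pos hε.out
  have hqQ : q ^ Q = (K : ℝ)⁻¹ := by
    rw [← Real.exp_mul, neg_mul, mul_div_cancel₀ _ hε.out.ne', Real.exp_neg,
      Real.exp_log (by positivity)]
  refine ⟨(q / diameter ε) ^ Q, by positivity, fun x r ⟨hr, hr_le⟩ => ?_⟩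
  obtain ⟨n, hn, hn'⟩ := exists_mul_pow_near hq (by simpa [q] using hε.out) hr hr_le
  calc ENNReal.ofReal ((q / diameter ε) ^ Q * r ^ Q)
      ≤ ENNReal.ofReal ((q / diameter ε) ^ Q * (diameter ε * q ^ n) ^ Q) := by gcongr
    _ = ENNReal.ofReal ((K : ℝ)⁻¹ ^ (n + 1)) := by
        rw [← Real.mul_rpow (by positivity) (by positivity), ← hqQ, Real.rpow_pow_comm hq.le]
        congr 2
        field_simp
        ring
    _ = ((K : ℝ≥0∞) ^ (n + 1))⁻¹ := by
        rw [inv_pow, ENNReal.ofReal_inv_of_pos (by positivity), ENNReal.ofReal_pow (by positivity),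
          ENNReal.ofReal_natCast]
    _ ≤ normalizedHausdorff (Boundary G o ε) Q (cylinder (n + 1) x) :=
        ENNReal.inv_le_iff_le_mul (by simp) (by simp) |>.2 <|
          one_le_pow_mul_cylinder hK hG (n + 1) x
    _ ≤ normalizedHausdorff (Boundary G o ε) Q (Metric.ball x r) :=
        measure_mono (cylinder_subset_ball hG.1 x hn)

end Measure

end TreeBoundary

theorem div_lt_and_le_sub_div_of_cases {p Q θ α : ℝ} (hp : 1 < p)
    (h : (Q < 1 ∧ (Q - 1) / p + 1 ≤ θ ∧ α = 1 - 1 / p) ∨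
      (Q / p < θ ∧ θ ≤ (Q - 1) / p + 1 ∧ θ < 1 ∧ α = θ - Q / p) ∨
      (1 ≤ Q ∧ 1 ≤ θ ∧ 0 < α ∧ α < 1 - Q / p)) :
    Q / p < θ ∧ α ≤ θ - Q / p := by
  have hp' : 1 / p < 1 := (div_lt_one (one_pos.trans hp)).2 hp
  rw [sub_div] at h
  rcases h with ⟨-, hθ, hα⟩ | ⟨hθ, -, -, hα⟩ | ⟨-, hθ, hα0, hα⟩
  · constructor <;> linarith
  · exact ⟨hθ, hα.le⟩
  · constructor <;> linarith

theorem proposition6p5_general {V : Type*} {G : SimpleGraph V} {o : V} {K : ℕ} (hK : K ≠ 0)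
    (hG : RootedTree.IsRegularTree G o K) {ε : ℝ} [hε : Fact (0 < ε)] {Q : ℝ}
    (hQ : Q = Real.log K / ε) {p : ℝ} (hp : 1 ≤ p) {θ : ℝ} (hθ : Q / p < θ) {α : ℝ≥0}
    (hα : α ≤ θ - Q / p) {u : RootedTree.Boundary G o ε → ℝ}
    (hu : Besov.MemBesov (Besov.normalizedHausdorff (RootedTree.Boundary G o ε) Q) θ p p u) :
    ∃ v : RootedTree.Boundary G o ε → ℝ,
      v =ᵐ[Besov.normalizedHausdorff (RootedTree.Boundary G o ε) Q] u ∧ MemHolder α v := by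
  subst hQ
  -- A Hausdorff measure of total mass `0` or `∞` is normalized to the zero measure.
  rcases eq_zero_or_isProbabilityMeasure
    (Besov.normalizedHausdorff (RootedTree.Boundary G o ε) (Real.log K / ε)) with hν | _
  · exact ⟨0, by simp [hν, Filter.EventuallyEq], memHolder_zero⟩
  have := TreeBoundary.isUltrametricDist (ε := ε) (o := o) hG.1
  exact Besov.exists_memHolder_of_memBesov
    (div_nonneg (Real.log_natCast_nonneg K) hε.out.le) (TreeBoundary.diameter_pos hε.out)
    (TreeBoundary.dist_le_diameter hG.1) (TreeBoundary.isLowerRegular_normalizedHausdorff hK hG)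
    hp hθ hα hu

theorem proposition6p5 {V : Type*} (G : SimpleGraph V) (o : V) (K : ℕ) (hK : 2 ≤ K)
    (hG : RootedTree.IsRegularTree G o K) (ε : ℝ) [Fact (0 < ε)]
    (Q : ℝ) (hQ : Q = Real.log K / ε) (ν : MeasureTheory.Measure (RootedTree.Boundary G o ε))
    (hν : ν = Besov.normalizedHausdorff (RootedTree.Boundary G o ε) Q)
    (p : ℝ) (hp : 1 < p) (θ : ℝ) (α : NNReal)
    (h : (Q < 1 ∧ (Q - 1) / p + 1 ≤ θ ∧ (α : ℝ) = 1 - 1 / p) ∨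
      (Q / p < θ ∧ θ ≤ (Q - 1) / p + 1 ∧ θ < 1 ∧ (α : ℝ) = θ - Q / p) ∨
      (1 ≤ Q ∧ 1 ≤ θ ∧ 0 < (α : ℝ) ∧ (α : ℝ) < 1 - Q / p))
    (u : RootedTree.Boundary G o ε → ℝ) (hu : Besov.MemBesov ν θ p p u) :
    ∃ v : RootedTree.Boundary G o ε → ℝ, v =ᵐ[ν] u ∧ MemHolder α v := by
  obtain ⟨hθ, hα⟩ := div_lt_and_le_sub_div_of_cases hp h
  exact hν ▸ proposition6p5_general (by lia) hG hQ hp.le hθ hα (hν ▸ hu)
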